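/- Let $n\ge 1$ and let $K_0,K_1,\dots,K_n$ be positive integers. Let $\mathbf H_1,\dots,\mathbf H_n$ be random complex matrices, $\mathbf H_i$ of size $K_i\times K_{i-1}$, all of whose entries are mutually independent (within and across the matrices) standard complex Gaussian random variables, i.e. with independent real and imaginary parts, each real Gaussian with mean $0$ and variance $1/2$. Put $\mathbf P_n=\mathbf H_n\cdots\mathbf H_1$ and let $$X=\|\mathbf P_n\|_{\mathrm F}^2=\operatorname{tr}(\mathbf P_n\mathbf P_n^\dagger),$$ which is the sum of the nonzero eigenvalues (with multiplicity) of $\mathbf P_n\mathbf P_n^\dagger$. Then the first three moments of $X$ are finite and given by $$\mathbb E[X]=\prod_{i=0}^n K_i,$$ $$\mathbb E[X^2]=\frac{\prod_{i=0}^n K_i}{2}\left(\prod_{i=0}^n(K_i+1)+\prod_{i=0}^n(K_i-1)\right),$$ $$\mathbb E[X^3]=\frac{\prod_{i=0}^n K_i}{6}\left(\prod_{i=0}^n(K_i+2)(K_i+1)+4\prod_{i=0}^n(K_i+1)(K_i-1)+\prod_{i=0}^n(K_i-1)(K_i-2)\right).$$ -/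

import Mathlib

open MeasureTheory ProbabilityTheory

noncomputable section

/-- The standard (circularly symmetric) complex Gaussian law on `ℂ`: real and imaginary parts are
independent centred real Gaussians of variance `1 / 2`, so that `𝔼 |Z|² = 1`. -/
def stdComplexGaussian : Measure ℂ :=
  ((gaussianReal 0 (1 / 2)).prod (gaussianReal 0 (1 / 2))).map Complex.measurableEquivRealProd.symm

/-- The product `H_n ⋯ H_1`, where `H_{i+1}` (written `H i`) is a `K_{i+1} × K_i` matrix; the empty
product is the identity matrix. -/
def channelProd (K : ℕ → ℕ) (H : (i : ℕ) → Matrix (Fin (K (i + 1))) (Fin (K i)) ℂ) :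
    (n : ℕ) → Matrix (Fin (K n)) (Fin (K 0)) ℂ
  | 0 => 1
  | n + 1 => H n * channelProd K H n

/-- The squared Frobenius norm `‖A‖_F² = ∑ |A_{jk}|²`. -/
def frobeniusSq {p q : ℕ} (A : Matrix (Fin p) (Fin q) ℂ) : ℝ :=
  ∑ j, ∑ k, ‖A j k‖ ^ 2

/-- `‖A‖_F² = tr (A A†)`. -/
theorem frobeniusSq_eq_trace {p q : ℕ} (A : Matrix (Fin p) (Fin q) ℂ) :
    ((frobeniusSq A : ℝ) : ℂ) = (A * A.conjTranspose).trace := by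
  simp [frobeniusSq, Matrix.trace, Matrix.mul_apply, Complex.mul_conj, Complex.normSq_eq_norm_sq]

/-- `‖A‖_F²` is the sum of the nonzero eigenvalues (with multiplicity) of `A A†`. -/
theorem frobeniusSq_eq_sum_eigenvalues {p q : ℕ} (A : Matrix (Fin p) (Fin q) ℂ) :
    frobeniusSq A =
      ∑ j with (Matrix.isHermitian_mul_conjTranspose_self A).eigenvalues j ≠ 0,
        (Matrix.isHermitian_mul_conjTranspose_self A).eigenvalues j := by
  rw [Finset.sum_filter_ne_zero]
  have h := (Matrix.isHermitian_mul_conjTranspose_self A).trace_eq_sum_eigenvalues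
  rw [← frobeniusSq_eq_trace] at h
  exact Complex.ofReal_injective (h.trans (by simp))

/-- `X = ‖P_n‖_F²`, the squared Frobenius norm of `P_n = H_n ⋯ H_1`, as a random variable. -/
def channelGain {Ω : Type*} (K : ℕ → ℕ)
    (H : (i : ℕ) → Ω → Matrix (Fin (K (i + 1))) (Fin (K i)) ℂ) (n : ℕ) (ω : Ω) : ℝ :=
  frobeniusSq (channelProd K (fun i => H i ω) n)

end

/-! Since `X ^ k` is the `permTrace` of `P_n P_n†` at the identity of `S_k`, it suffices to follow
the expected permutation traces through the layers. Wick's formula shows that one Gaussian layer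
with `m` rows acts on them as convolution over `S_k` with `m ^ (number of cycles)`
(`integral_permTrace_mul_mul_conjTranspose`). This kernel is a class function, so irreducible
characters are simultaneous eigenvectors for all `m`; the eigenvalue is the product of `m + content`
over the boxes of the Young diagram. Paired with a character, the expectation thus picks up one such
factor per dimension `K_i` (`integral_sum_mul_permTrace_channelProd`). Expanding the indicator of
the identity in characters, with weights `dim / k!`, gives the moments; for `k ≤ 3` the eigenvector
identities are finite checks. -/

/-! ### Density of the complex Gaussian law. -/

theorem stdComplexGaussian_eq_withDensity :
    stdComplexGaussian =
      volume.withDensity fun z : ℂ => ENNReal.ofReal (Real.pi⁻¹ * Real.exp (-‖z‖ ^ 2)) := by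
  have hv : (1 / 2 : NNReal) ≠ 0 := by norm_num
  have hm : (volume : Measure (ℝ × ℝ)).map Complex.measurableEquivRealProd.symm = volume :=
    Complex.volume_preserving_equiv_real_prod.symm.map_eq
  unfold stdComplexGaussian
  rw [gaussianReal_of_var_ne_zero _ hv,
    prod_withDensity (measurable_gaussianPDF _ _) (measurable_gaussianPDF _ _),
    ← Measure.volume_eq_prod, ← hm]
  ext s hs
  rw [Measure.map_apply Complex.measurableEquivRealProd.symm.measurable hs,
    withDensity_apply _ (Complex.measurableEquivRealProd.symm.measurable hs),
    withDensity_apply _ hs, setLIntegral_map hs (by fun_prop)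
      Complex.measurableEquivRealProd.symm.measurable]
  refine lintegral_congr fun x => ?_
  rw [gaussianPDF, gaussianPDF, ← ENNReal.ofReal_mul (gaussianPDFReal_nonneg _ _ _)]
  congr 1
  have hn : ‖Complex.measurableEquivRealProd.symm x‖ ^ 2 = x.1 ^ 2 + x.2 ^ 2 := by
    rw [Complex.sq_norm, Complex.normSq_apply]
    simp [Complex.measurableEquivRealProd, sq]
  rw [hn]
  simp only [gaussianPDFReal, sub_zero]
  have h2 : (2 * ((1 / 2 : NNReal) : ℝ)) = 1 := by norm_num
  have h3 : 2 * Real.pi * ((1 / 2 : NNReal) : ℝ) = Real.pi := by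
    rw [mul_right_comm, h2, one_mul]
  rw [h2, h3, neg_add, Real.exp_add, mul_mul_mul_comm, ← mul_inv,
    Real.mul_self_sqrt Real.pi_pos.le]
  simp

/-! ### Finiteness and values of mixed moments. -/

/-- A random variable all of whose absolute moments of finite order are finite. -/
def HasAllMoments {Ω : Type*} [MeasurableSpace Ω] (f : Ω → ℂ) (μ : Measure Ω) : Prop :=
  ∀ p : NNReal, MemLp f p μ

namespace HasAllMoments

variable {Ω : Type*} [MeasurableSpace Ω] {μ : Measure Ω} {f g : Ω → ℂ}

theorem mul (hf : HasAllMoments f μ) (hg : HasAllMoments g μ) :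
    HasAllMoments (fun ω => f ω * g ω) μ := by
  intro p
  -- Hölder with exponents `2p, 2p`: this is why the class with all moments is closed under
  -- products.
  have : ENNReal.HolderTriple ((2 * p : NNReal) : ENNReal) ((2 * p : NNReal) : ENNReal) p := by
    constructor
    push_cast
    rw [ENNReal.mul_inv (by simp) (by simp), ← add_mul, ENNReal.inv_two_add_inv_two, one_mul]
  exact MemLp.mul' (hg (2 * p)) (hf (2 * p))

theorem conj (hf : HasAllMoments f μ) :
    HasAllMoments (fun ω => (starRingEnd ℂ) (f ω)) μ := fun p => (hf p).star

theorem const [IsFiniteMeasure μ] (c : ℂ) : HasAllMoments (fun _ => c) μ :=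
  fun _ => memLp_const c

theorem sum {ι : Type*} (s : Finset ι) {f : ι → Ω → ℂ} (hf : ∀ i ∈ s, HasAllMoments (f i) μ) :
    HasAllMoments (fun ω => ∑ i ∈ s, f i ω) μ := fun p => memLp_finsetSum s fun i hi => hf i hi p

theorem prod [IsFiniteMeasure μ] {ι : Type*} (s : Finset ι) {f : ι → Ω → ℂ}
    (hf : ∀ i ∈ s, HasAllMoments (f i) μ) :
    HasAllMoments (fun ω => ∏ i ∈ s, f i ω) μ := by
  classical
  induction s using Finset.induction_on with
  | empty => simpa using const 1
  | insert a s ha ih =>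
    simp only [Finset.prod_insert ha]
    exact (hf a (by simp)).mul (ih fun i hi => hf i (by simp [hi]))

theorem integrable (hf : HasAllMoments f μ) : Integrable f μ := by
  have := hf 1
  rwa [ENNReal.coe_one, memLp_one_iff_integrable] at this

end HasAllMoments

theorem hasAllMoments_id_stdComplexGaussian : HasAllMoments (fun z => z) stdComplexGaussian := by
  intro p
  unfold stdComplexGaussian
  rw [memLp_map_measure_iff (by fun_prop) (by fun_prop)]
  have h1 : MemLp (fun x : ℝ × ℝ => (x.1 : ℂ)) p
      ((gaussianReal 0 (1 / 2)).prod (gaussianReal 0 (1 / 2))) :=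
    ((memLp_id_gaussianReal p).comp_measurePreserving measurePreserving_fst).ofReal
  have h2 : MemLp (fun x : ℝ × ℝ => (x.2 : ℂ)) p
      ((gaussianReal 0 (1 / 2)).prod (gaussianReal 0 (1 / 2))) :=
    ((memLp_id_gaussianReal p).comp_measurePreserving measurePreserving_snd).ofReal
  refine (h1.add (h2.mul_const Complex.I)).congr_norm (by fun_prop) (ae_of_all _ fun x => ?_)
  congr 1
  apply Complex.ext <;> simp [Complex.measurableEquivRealProd]

theorem hasAllMoments_of_hasLaw {Ω : Type*} [MeasurableSpace Ω] {μ : Measure Ω} {z : Ω → ℂ}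
    (hz : HasLaw z stdComplexGaussian μ) : HasAllMoments z μ := by
  intro p
  have h := hasAllMoments_id_stdComplexGaussian p
  rw [← hz.map_eq, memLp_map_measure_iff (by fun_prop) hz.aemeasurable] at h
  exact h

theorem integral_stdComplexGaussian (f : ℂ → ℂ) :
    ∫ z, f z ∂stdComplexGaussian = ∫ z : ℂ, ((Real.pi⁻¹ * Real.exp (-‖z‖ ^ 2) : ℝ) : ℂ) * f z := by
  rw [stdComplexGaussian_eq_withDensity,
    integral_withDensity_eq_integral_toReal_smul (by fun_prop) (by simp)]
  refine integral_congr_ae (ae_of_all _ fun z => ?_)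
  simp only
  rw [ENNReal.toReal_ofReal (by positivity), Complex.real_smul]

theorem integral_stdComplexGaussian_rotate (c : Circle) (f : ℂ → ℂ) :
    ∫ z, f (c * z) ∂stdComplexGaussian = ∫ z, f z ∂stdComplexGaussian := by
  rw [integral_stdComplexGaussian, integral_stdComplexGaussian]
  rw [← (rotation c).measurePreserving.integral_comp
    (rotation c).toHomeomorph.measurableEmbedding
    (fun z : ℂ => ((Real.pi⁻¹ * Real.exp (-‖z‖ ^ 2) : ℝ) : ℂ) * f z)]
  simp only [rotation_apply, norm_mul, Circle.norm_coe, one_mul]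

theorem integral_norm_pow_stdComplexGaussian (a : ℕ) :
    ∫ z, ((‖z‖ ^ (2 * a) : ℝ) : ℂ) ∂stdComplexGaussian = (a.factorial : ℂ) := by
  rw [integral_stdComplexGaussian]
  have h := Complex.integral_rpow_mul_exp_neg_rpow (p := 2) (q := (2 * a : ℕ)) (by norm_num)
    (by have : (0 : ℝ) ≤ ((2 * a : ℕ) : ℝ) := by positivity
        linarith)
  have h2 : ((((2 * a : ℕ) : ℝ) + 2) / 2) = a + 1 := by push_cast; ring
  rw [h2, Real.Gamma_nat_eq_factorial] at h
  simp only [Real.rpow_natCast, Real.rpow_ofNat] at h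
  simp_rw [← Complex.ofReal_mul]
  rw [integral_complex_ofReal]
  have h3 : ∀ z : ℂ, Real.pi⁻¹ * Real.exp (-‖z‖ ^ 2) * ‖z‖ ^ (2 * a) =
      Real.pi⁻¹ * (‖z‖ ^ (2 * a) * Real.exp (-‖z‖ ^ 2)) := fun z => by ring
  simp_rw [h3]
  rw [integral_const_mul, h]
  have := Real.pi_ne_zero
  rw [show Real.pi⁻¹ * (2 * Real.pi / 2 * (a.factorial : ℝ)) = (a.factorial : ℝ) by field_simp]
  simp

theorem integral_pow_mul_conj_pow_stdComplexGaussian (a b : ℕ) :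
    ∫ z, z ^ a * (starRingEnd ℂ) z ^ b ∂stdComplexGaussian =
      if a = b then (a.factorial : ℂ) else 0 := by
  split_ifs with hab
  · subst hab
    rw [← integral_norm_pow_stdComplexGaussian]
    refine integral_congr_ae (ae_of_all _ fun z => ?_)
    simp only
    rw [← mul_pow, Complex.mul_conj, Complex.normSq_eq_norm_sq, ← Complex.ofReal_pow, ← pow_mul]
  · have hd : ((a : ℝ) - b) ≠ 0 := sub_ne_zero.mpr (by exact_mod_cast hab)
    have hd' : ((a : ℂ) - b) ≠ 0 := sub_ne_zero.mpr (by exact_mod_cast hab)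
    -- This rotation multiplies the integrand by `-1`, so the integral equals its own negative.
    set c : Circle := Circle.exp (Real.pi / (a - b))
    have hc : (c : ℂ) ^ a * (starRingEnd ℂ) (c : ℂ) ^ b = -1 := by
      rw [Circle.coe_exp, ← Complex.exp_conj, ← Complex.exp_nat_mul, ← Complex.exp_nat_mul,
        ← Complex.exp_add, ← Complex.exp_pi_mul_I]
      congr 1
      simp only [map_mul, Complex.conj_ofReal, Complex.conj_I]
      push_cast
      field_simp
      ring
    have h := integral_stdComplexGaussian_rotate c fun z => z ^ a * (starRingEnd ℂ) z ^ b
    have h2 : ∀ z : ℂ, (c * z) ^ a * (starRingEnd ℂ) (c * z) ^ b =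
        -1 * (z ^ a * (starRingEnd ℂ) z ^ b) := fun z => by
      rw [map_mul, mul_pow, mul_pow, ← hc]; ring
    simp only [h2] at h
    rw [integral_const_mul] at h
    linear_combination (-1 / 2) * h

/-! ### Wick's formula. -/

open Equiv in
-- A solution `π` exists exactly when the fibres of `a` and `b` have equal sizes; the solutions then
-- form a coset of the stabilizer of `a`, whose order is the product of the factorials of the fibre
-- sizes.
theorem sum_perm_ite_eq_comp {α ι : Type*} [Fintype α] [DecidableEq α] [Fintype ι] [DecidableEq ι]
    (a b : α → ι) :
    (∑ π : Perm α, if a = b ∘ π then (1 : ℂ) else 0) =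
      ∏ e, if Fintype.card {s // a s = e} = Fintype.card {s // b s = e} then
        ((Fintype.card {s // a s = e}).factorial : ℂ) else 0 := by
  by_cases h : ∀ e, Fintype.card {s // a s = e} = Fintype.card {s // b s = e}
  · have e : ∀ c, {s // a s = c} ≃ {s // b s = c} := fun c => Fintype.equivOfCardEq (h c)
    set π₀ : Perm α := Equiv.ofFiberEquiv e
    have hπ : ∀ s, b (π₀ s) = a s := fun s => Equiv.ofFiberEquiv_map e s
    simp only [h, if_true]
    simp only [← h]
    rw [← Nat.cast_prod, ← DomMulAct.stabilizer_card a, Fintype.card_subtype,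
      ← Equiv.sum_comp (Equiv.mulLeft π₀)]
    rw [Finset.sum_boole]
    congr 3
    ext g
    have : b ∘ (Equiv.mulLeft π₀ g) = a ∘ g := by
      ext s; simp [hπ]
    rw [this, eq_comm]
  · push Not at h
    obtain ⟨e, he⟩ := h
    rw [Finset.prod_eq_zero (Finset.mem_univ e) (by simp [he])]
    refine Finset.sum_eq_zero fun π _ => if_neg fun hab => he ?_
    refine Fintype.card_congr (π.subtypeEquiv fun s => ?_)
    rw [hab]; rfl

theorem prod_comp_eq_prod_pow_card {α ι M : Type*} [Fintype α] [Fintype ι] [DecidableEq ι]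
    [CommMonoid M] (a : α → ι) (f : ι → M) :
    ∏ s, f (a s) = ∏ e, f e ^ Fintype.card {s // a s = e} := by
  rw [← Finset.prod_fiberwise Finset.univ a]
  refine Finset.prod_congr rfl fun e _ => ?_
  rw [Finset.prod_congr rfl (g := fun _ => f e), Finset.prod_const, Fintype.card_subtype]
  intro s hs
  rw [(Finset.mem_filter.mp hs).2]

/-- Wick's formula for a finite family of independent standard complex Gaussians. -/
theorem integral_prod_mul_conj_eq_sum_perm {Ω : Type*} [MeasurableSpace Ω] {μ : Measure Ω}
    {α ι : Type*} [Fintype α] [DecidableEq α] [Fintype ι] [DecidableEq ι]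
    {z : ι → Ω → ℂ} (hz : ∀ i, HasLaw (z i) stdComplexGaussian μ) (hind : iIndepFun z μ)
    (a b : α → ι) :
    ∫ ω, ∏ s, (z (a s) ω * (starRingEnd ℂ) (z (b s) ω)) ∂μ =
      ∑ π : Equiv.Perm α, if a = b ∘ π then (1 : ℂ) else 0 := by
  rw [sum_perm_ite_eq_comp]
  -- Grouping the factors by variable lets independence split the expectation.
  have h1 : ∀ ω, ∏ s, (z (a s) ω * (starRingEnd ℂ) (z (b s) ω)) =
      ∏ e, (fun w : ℂ => w ^ Fintype.card {s // a s = e} *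
        (starRingEnd ℂ) w ^ Fintype.card {s // b s = e}) (z e ω) := fun ω => by
    rw [Finset.prod_mul_distrib, prod_comp_eq_prod_pow_card a (fun e => z e ω),
      prod_comp_eq_prod_pow_card b (fun e => (starRingEnd ℂ) (z e ω)), ← Finset.prod_mul_distrib]
  have hm : ∀ k l : ℕ, Continuous fun w : ℂ => w ^ k * (starRingEnd ℂ) w ^ l := fun k l =>
    (continuous_pow k).mul (Complex.continuous_conj.pow l)
  simp_rw [h1]
  rw [hind.integral_fun_prod_comp (fun i => (hz i).aemeasurable)
    (fun i => (hm _ _).aestronglyMeasurable)]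
  refine Finset.prod_congr rfl fun e _ => ?_
  rw [← integral_pow_mul_conj_pow_stdComplexGaussian]
  exact (hz e).integral_comp (hm _ _).aestronglyMeasurable

/-! ### Permutation traces and the effect of one Gaussian layer. -/

/-- The product of the traces of powers of `B` over the cycles of `σ`:
`∑ B_{i₁ i_σ(1)} B_{i₂ i_σ(2)} ⋯`. -/
noncomputable def permTrace {α ι : Type*} [Fintype α] [DecidableEq α] [Fintype ι]
    (σ : Equiv.Perm α) (B : Matrix ι ι ℂ) : ℂ :=
  ∑ i : α → ι, ∏ s, B (i s) (i (σ s))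

section

variable {α ι κ : Type*} [Fintype α] [DecidableEq α] [Fintype ι] [Fintype κ]

theorem permTrace_refl (B : Matrix ι ι ℂ) :
    permTrace (1 : Equiv.Perm α) B = B.trace ^ Fintype.card α := by
  simp only [permTrace, Equiv.Perm.one_apply, Matrix.trace, Matrix.diag_apply]
  rw [← Finset.card_univ, ← Finset.prod_const, Finset.prod_univ_sum, Fintype.piFinset_univ]

/-- The sum counts labelings constant on the cycles of `σ`, hence equals the size of `ι` to the
number of cycles. -/
theorem permTrace_one [DecidableEq ι] (σ : Equiv.Perm α) :
    permTrace σ (1 : Matrix ι ι ℂ) = ∑ i : α → ι, if i = i ∘ σ then 1 else 0 := by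
  unfold permTrace
  refine Finset.sum_congr rfl fun i _ => ?_
  simp only [Matrix.one_apply]
  rw [Finset.prod_ite_zero]
  simp [funext_iff]

theorem permTrace_mul_mul_conjTranspose (σ : Equiv.Perm α) (A : Matrix κ ι ℂ) (B : Matrix ι ι ℂ) :
    permTrace σ (A * B * A.conjTranspose) =
      ∑ k : α → κ, ∑ q : α → ι × ι,
        (∏ s, (A (k s) (q s).1 * (starRingEnd ℂ) (A (k (σ s)) (q s).2))) *
          ∏ s, B (q s).1 (q s).2 := by
  unfold permTrace
  refine Finset.sum_congr rfl fun k _ => ?_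
  have h : ∀ s, (A * B * A.conjTranspose) (k s) (k (σ s)) = ∑ q : ι × ι,
      (A (k s) q.1 * (starRingEnd ℂ) (A (k (σ s)) q.2)) * B q.1 q.2 := fun s => by
    simp only [Matrix.mul_apply, Matrix.conjTranspose_apply, Finset.sum_mul,
      Fintype.sum_prod_type]
    rw [Finset.sum_comm]
    refine Finset.sum_congr rfl fun i _ => Finset.sum_congr rfl fun j _ => ?_
    rw [starRingEnd_apply]; ring
  simp_rw [h]
  rw [Finset.prod_univ_sum, Fintype.piFinset_univ]
  simp_rw [Finset.prod_mul_distrib]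

theorem sum_ite_fst_eq_snd_comp [DecidableEq ι] (π : Equiv.Perm α) (G : (α → ι × ι) → ℂ) :
    (∑ q : α → ι × ι, (if Prod.fst ∘ q = Prod.snd ∘ q ∘ π then 1 else 0) * G q) =
      ∑ j : α → ι, G fun s => (j (π s), j s) := by
  rw [← (Equiv.arrowProdEquivProdArrow α (fun _ => ι) (fun _ => ι)).symm.sum_comp,
    Fintype.sum_prod_type, Finset.sum_comm]
  refine Finset.sum_congr rfl fun j _ => ?_
  rw [Finset.sum_eq_single (j ∘ π)]
  · simp [Equiv.arrowProdEquivProdArrow, funext_iff]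
  · intro i _ hi
    rw [if_neg, zero_mul]
    intro h
    exact hi h
  · simp

variable {Ω : Type*} [MeasurableSpace Ω] {μ : Measure Ω} [IsProbabilityMeasure μ]

theorem HasAllMoments.permTrace {B : Ω → Matrix ι ι ℂ}
    (hB : ∀ i j, HasAllMoments (fun ω => B ω i j) μ) (σ : Equiv.Perm α) :
    HasAllMoments (fun ω => permTrace σ (B ω)) μ :=
  .sum _ fun _ _ => .prod _ fun _ _ => hB _ _

/-- Each Wick pairing `π` imposes separate constraints on rows and columns: the row labels must be
invariant under `σ * π`, and the column labels contract `B` along `π⁻¹`. -/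
theorem integral_permTrace_mul_mul_conjTranspose [DecidableEq ι] [DecidableEq κ]
    {A : Ω → Matrix κ ι ℂ} {B : Ω → Matrix ι ι ℂ}
    (hA : ∀ k i, HasLaw (fun ω => A ω k i) stdComplexGaussian μ)
    (hAi : iIndepFun (fun (e : κ × ι) ω => A ω e.1 e.2) μ)
    (hB : ∀ i j, HasAllMoments (fun ω => B ω i j) μ)
    (hAB : IndepFun (fun ω (e : κ × ι) => A ω e.1 e.2) (fun ω (e : ι × ι) => B ω e.1 e.2) μ)
    (σ : Equiv.Perm α) :
    ∫ ω, permTrace σ (A ω * B ω * (A ω).conjTranspose) ∂μ =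
      ∑ π : Equiv.Perm α, permTrace (σ * π) (1 : Matrix κ κ ℂ) *
        ∫ ω, permTrace π⁻¹ (B ω) ∂μ := by
  have hAm : ∀ k i, HasAllMoments (fun ω => A ω k i) μ := fun k i =>
    hasAllMoments_of_hasLaw (hA k i)
  have hPA : ∀ (k : α → κ) (q : α → ι × ι), HasAllMoments (fun ω => ∏ s,
      (A ω (k s) (q s).1 * (starRingEnd ℂ) (A ω (k (σ s)) (q s).2))) μ := fun k q =>
    .prod _ fun _ _ => (hAm _ _).mul (hAm _ _).conj
  have hPB : ∀ q : α → ι × ι, HasAllMoments (fun ω => ∏ s, B ω (q s).1 (q s).2) μ := fun q =>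
    .prod _ fun _ _ => hB _ _
  simp_rw [permTrace_mul_mul_conjTranspose]
  rw [integral_finsetSum _ fun k _ => integrable_finsetSum _ fun q _ =>
    ((hPA k q).mul (hPB q)).integrable]
  have hterm : ∀ (k : α → κ) (q : α → ι × ι),
      ∫ ω, (∏ s, (A ω (k s) (q s).1 * (starRingEnd ℂ) (A ω (k (σ s)) (q s).2))) *
        (∏ s, B ω (q s).1 (q s).2) ∂μ =
      ∑ π : Equiv.Perm α, (if k = k ∘ (σ * π) then 1 else 0) *
        ((if Prod.fst ∘ q = Prod.snd ∘ q ∘ π then 1 else 0) *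
          ∫ ω, ∏ s, B ω (q s).1 (q s).2 ∂μ) := fun k q => by
    have hf : Continuous fun v : κ × ι → ℂ =>
        ∏ s, (v (k s, (q s).1) * (starRingEnd ℂ) (v (k (σ s), (q s).2))) :=
      continuous_finsetProd _ fun s _ =>
        (continuous_apply _).mul (Complex.continuous_conj.comp (continuous_apply _))
    have hg : Continuous fun v : ι × ι → ℂ => ∏ s, v (q s) := by fun_prop
    have := (hAB.comp hf.measurable hg.measurable).integral_fun_mul_eq_mul_integral
      (hPA k q).integrable.aestronglyMeasurable (hPB q).integrable.aestronglyMeasurable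
    simp only [Function.comp_apply] at this
    rw [this]
    have hw := integral_prod_mul_conj_eq_sum_perm (z := fun (e : κ × ι) ω => A ω e.1 e.2)
      (fun e => hA e.1 e.2) hAi (fun s => (k s, (q s).1)) (fun s => (k (σ s), (q s).2))
    simp only at hw
    rw [hw, Finset.sum_mul]
    refine Finset.sum_congr rfl fun π _ => ?_
    rw [← mul_assoc]
    congr 1
    rw [ite_zero_mul_ite_zero, mul_one]
    refine if_congr ?_ rfl rfl
    simp [funext_iff, Prod.ext_iff, forall_and]
  have hsum : ∀ k : α → κ,
      ∫ ω, ∑ q : α → ι × ι, (∏ s, (A ω (k s) (q s).1 *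
        (starRingEnd ℂ) (A ω (k (σ s)) (q s).2))) * (∏ s, B ω (q s).1 (q s).2) ∂μ =
      ∑ π : Equiv.Perm α, (if k = k ∘ (σ * π) then 1 else 0) *
        ∫ ω, permTrace π⁻¹ (B ω) ∂μ := fun k => by
    rw [integral_finsetSum _ fun q _ => ((hPA k q).mul (hPB q)).integrable]
    simp_rw [hterm]
    rw [Finset.sum_comm]
    refine Finset.sum_congr rfl fun π _ => ?_
    rw [← Finset.mul_sum, sum_ite_fst_eq_snd_comp π fun q => ∫ ω, ∏ s, B ω (q s).1 (q s).2 ∂μ,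
      ← integral_finsetSum _ fun j _ => (hPB _).integrable]
    congr 1
    refine integral_congr_ae (ae_of_all _ fun ω => ?_)
    refine Finset.sum_congr rfl fun j _ => ?_
    rw [← Equiv.prod_comp π fun s => B ω (j s) (j (π⁻¹ s))]
    simp
  simp_rw [hsum]
  rw [Finset.sum_comm]
  simp_rw [permTrace_one, Finset.sum_mul]

end

/-! ### Iteration over the layers. -/

section

variable (K : ℕ → ℕ)

theorem channelProd_congr {H H' : (i : ℕ) → Matrix (Fin (K (i + 1))) (Fin (K i)) ℂ} {n : ℕ}
    (h : ∀ i < n, H i = H' i) : channelProd K H n = channelProd K H' n := by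
  induction n with
  | zero => rfl
  | succ n ih =>
    simp only [channelProd]
    rw [h n n.lt_succ_self, ih fun i hi => h i (hi.trans n.lt_succ_self)]

theorem measurable_channelProd {β : Type*} [MeasurableSpace β]
    {H : (i : ℕ) → β → Matrix (Fin (K (i + 1))) (Fin (K i)) ℂ}
    (hH : ∀ i j k, Measurable fun x => H i x j k) (n : ℕ) :
    ∀ j k, Measurable fun x => channelProd K (fun i => H i x) n j k := by
  induction n with
  | zero => intro j k; simp only [channelProd]; exact measurable_const
  | succ n ih =>
    intro j k
    simp only [channelProd, Matrix.mul_apply]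
    exact Finset.measurable_sum _ fun l _ => (hH n j l).mul (ih l k)

variable {Ω : Type*} [MeasurableSpace Ω] {μ : Measure Ω} {K}
  {N : ℕ} {H : (i : ℕ) → Ω → Matrix (Fin (K (i + 1))) (Fin (K i)) ℂ}

theorem hasAllMoments_channelProd [IsFiniteMeasure μ]
    (hlaw : ∀ i < N, ∀ (j : Fin (K (i + 1))) (k : Fin (K i)),
      HasLaw (fun ω => H i ω j k) stdComplexGaussian μ) {n : ℕ} (hn : n ≤ N) :
    ∀ j k, HasAllMoments (fun ω => channelProd K (fun i => H i ω) n j k) μ := by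
  induction n with
  | zero => intro j k; simp only [channelProd]; exact .const _
  | succ n ih =>
    intro j k
    simp only [channelProd, Matrix.mul_apply]
    exact .sum _ fun l _ => (hasAllMoments_of_hasLaw (hlaw n hn j l)).mul
      (ih (Nat.le_of_succ_le hn) l k)

theorem indepFun_channelProd
    (hlaw : ∀ i < N, ∀ (j : Fin (K (i + 1))) (k : Fin (K i)),
      HasLaw (fun ω => H i ω j k) stdComplexGaussian μ)
    (hindep : iIndepFun
      (fun (e : Σ i : Fin N, Fin (K ((i : ℕ) + 1)) × Fin (K (i : ℕ))) (ω : Ω) =>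
        H (e.1 : ℕ) ω e.2.1 e.2.2) μ) {n : ℕ} (hn : n < N) :
    IndepFun (fun ω (e : Fin (K (n + 1)) × Fin (K n)) => H n ω e.1 e.2)
      (fun ω (e : Fin (K n) × Fin (K 0)) => channelProd K (fun i => H i ω) n e.1 e.2) μ := by
  classical
  let I := Σ i : Fin N, Fin (K ((i : ℕ) + 1)) × Fin (K (i : ℕ))
  let S : Finset I := Finset.univ.filter fun e => (e.1 : ℕ) = n
  let T : Finset I := Finset.univ.filter fun e => (e.1 : ℕ) < n
  have hST : Disjoint S T := by
    refine Finset.disjoint_filter.mpr fun e _ h => ?_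
    omega
  have hind := hindep.indepFun_finset₀ S T hST fun e =>
    (hlaw e.1 e.1.2 e.2.1 e.2.2).aemeasurable
  -- The value `0` for `i ≥ n` is never read by the product of the layers below `n`.
  let past : (T → ℂ) → (i : ℕ) → Matrix (Fin (K (i + 1))) (Fin (K i)) ℂ := fun t i j k =>
    if h : i < n then t ⟨⟨⟨i, h.trans hn⟩, (j, k)⟩, by simp [T, h]⟩ else 0
  have hφ : Measurable fun (t : S → ℂ) (e : Fin (K (n + 1)) × Fin (K n)) =>
      t ⟨⟨⟨n, hn⟩, e⟩, by simp [S]⟩ := by fun_prop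
  have hpast : ∀ i j k, Measurable fun t => past t i j k := fun i j k => by
    simp only [past]
    split_ifs <;> fun_prop
  have hψ : Measurable fun (t : T → ℂ) (e : Fin (K n) × Fin (K 0)) =>
      channelProd K (past t) n e.1 e.2 :=
    measurable_pi_lambda _ fun e => measurable_channelProd K (H := fun i t => past t i) hpast n _ _
  have hp : ∀ ω, channelProd K (past fun e : T => H (e.1.1 : ℕ) ω e.1.2.1 e.1.2.2) n =
      channelProd K (fun i => H i ω) n := fun ω => by
    refine channelProd_congr K fun i hi => ?_
    ext j k
    simp [past, hi]
  have h := hind.comp hφ hψ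
  simpa only [Function.comp_def, hp] using h

/-- `f` is an eigenvector, with eigenvalue `c m`, of convolution by the class function
`σ ↦ m ^ (number of cycles of σ)`. -/
def IsCycleEigenvector {α : Type*} [Fintype α] [DecidableEq α] (f : Equiv.Perm α → ℂ)
    (c : ℕ → ℂ) : Prop :=
  ∀ (m : ℕ) (π : Equiv.Perm α),
    ∑ σ, f σ * permTrace (σ * π) (1 : Matrix (Fin m) (Fin m) ℂ) = c m * f π⁻¹

/-- Each layer contributes one eigenvalue. The factor `c (K 0)` comes from the empty product, the
identity of size `K 0`, through the eigenvector equation at `π = 1`. -/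
theorem integral_sum_mul_permTrace_channelProd [IsProbabilityMeasure μ]
    {α : Type*} [Fintype α] [DecidableEq α]
    (hlaw : ∀ i < N, ∀ (j : Fin (K (i + 1))) (k : Fin (K i)),
      HasLaw (fun ω => H i ω j k) stdComplexGaussian μ)
    (hindep : iIndepFun
      (fun (e : Σ i : Fin N, Fin (K ((i : ℕ) + 1)) × Fin (K (i : ℕ))) (ω : Ω) =>
        H (e.1 : ℕ) ω e.2.1 e.2.2) μ)
    {f : Equiv.Perm α → ℂ} {c : ℕ → ℂ} (hf : IsCycleEigenvector f c) {n : ℕ} (hn : n ≤ N) :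
    ∑ σ, f σ * ∫ ω, permTrace σ (channelProd K (fun i => H i ω) n *
      (channelProd K (fun i => H i ω) n).conjTranspose) ∂μ =
      f 1 * ∏ i ∈ Finset.range (n + 1), c (K i) := by
  induction n with
  | zero =>
    have h := hf (K 0) 1
    simp only [mul_one, inv_one] at h
    simp [channelProd, h, mul_comm]
  | succ n ih =>
    have hinj : Function.Injective fun e : Fin (K (n + 1)) × Fin (K n) =>
        (⟨⟨n, hn⟩, e⟩ : Σ i : Fin N, Fin (K ((i : ℕ) + 1)) × Fin (K (i : ℕ))) :=
      fun a b h => by simpa using h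
    have hP := hasAllMoments_channelProd hlaw (Nat.le_of_succ_le hn)
    have hB : ∀ i j, HasAllMoments (fun ω => (channelProd K (fun i => H i ω) n *
        (channelProd K (fun i => H i ω) n).conjTranspose) i j) μ := fun i j => by
      simp only [Matrix.mul_apply, Matrix.conjTranspose_apply]
      exact .sum _ fun l _ => (hP i l).mul (hP j l).conj
    have hg : Measurable fun (v : Fin (K n) × Fin (K 0) → ℂ) (e : Fin (K n) × Fin (K n)) =>
        ∑ l, v (e.1, l) * star (v (e.2, l)) := by fun_prop
    have hstep : ∀ σ : Equiv.Perm α, _ := fun σ =>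
      integral_permTrace_mul_mul_conjTranspose (A := H n)
        (B := fun ω => channelProd K (fun i => H i ω) n *
          (channelProd K (fun i => H i ω) n).conjTranspose) (hlaw n hn)
        (hindep.precomp hinj) hB ((indepFun_channelProd hlaw hindep hn).comp measurable_id hg) σ
    have hmul : ∀ ω, channelProd K (fun i => H i ω) (n + 1) *
        (channelProd K (fun i => H i ω) (n + 1)).conjTranspose =
        H n ω * (channelProd K (fun i => H i ω) n *
          (channelProd K (fun i => H i ω) n).conjTranspose) * (H n ω).conjTranspose := fun ω => by
      simp only [channelProd, Matrix.conjTranspose_mul, Matrix.mul_assoc]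
    simp_rw [hmul, hstep, Finset.mul_sum]
    rw [Finset.sum_comm]
    simp_rw [← mul_assoc, ← Finset.sum_mul]
    have hc : ∀ π : Equiv.Perm α, _ := hf (K (n + 1))
    simp_rw [hc]
    rw [← Equiv.sum_comp (Equiv.inv (Equiv.Perm α))]
    simp only [Equiv.inv_apply, inv_inv, mul_assoc, ← Finset.mul_sum]
    rw [ih (Nat.le_of_succ_le hn), Finset.prod_range_succ _ (n + 1)]
    ring

end

/-! ### Characters of the symmetric groups on one, two and three letters. -/

theorem permTrace_fin_one (σ : Equiv.Perm (Fin 1)) (m : ℕ) :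
    permTrace σ (1 : Matrix (Fin m) (Fin m) ℂ) = m := by
  rw [Subsingleton.elim σ 1, permTrace_refl]
  simp

theorem permTrace_fin_two (σ : Equiv.Perm (Fin 2)) (m : ℕ) :
    permTrace σ (1 : Matrix (Fin m) (Fin m) ℂ) =
      ((if σ = 1 then 1 else 0 : ℤ) : ℂ) * (m : ℂ) ^ 2 +
        ((if σ ≠ 1 then 1 else 0 : ℤ) : ℂ) * m := by
  by_cases h : σ = 1
  · rw [h, permTrace_refl]; simp
  · have h' : σ = Equiv.swap 0 1 := by revert σ; decide
    simp only [h, if_false, not_false_eq_true, if_true, ne_eq]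
    rw [h', permTrace, ← (finTwoArrowEquiv (Fin m)).symm.sum_comp, Fintype.sum_prod_type]
    simp [Matrix.one_apply, finTwoArrowEquiv]

theorem sum_fin_three_arrow {ι : Type*} [Fintype ι] (g : (Fin 3 → ι) → ℂ) :
    ∑ i, g i = ∑ x, ∑ y, ∑ z, g ![x, y, z] := by
  rw [← (Fin.consEquiv fun _ : Fin 3 => ι).sum_comp, Fintype.sum_prod_type]
  refine Finset.sum_congr rfl fun x _ => ?_
  rw [← (finTwoArrowEquiv ι).symm.sum_comp, Fintype.sum_prod_type]
  rfl

/-- In `S_3` the identity test and the sign determine the cycle count. Integer indicators keep the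
later coefficient identities decidable. -/
theorem permTrace_fin_three (σ : Equiv.Perm (Fin 3)) (m : ℕ) :
    permTrace σ (1 : Matrix (Fin m) (Fin m) ℂ) =
      ((if σ = 1 then 1 else 0 : ℤ) : ℂ) * (m : ℂ) ^ 3 +
        ((if Equiv.Perm.sign σ = -1 then 1 else 0 : ℤ) : ℂ) * (m : ℂ) ^ 2 +
        ((if σ ≠ 1 ∧ Equiv.Perm.sign σ = 1 then 1 else 0 : ℤ) : ℂ) * m := by
  have h : ∀ σ : Equiv.Perm (Fin 3), σ = 1 ∨ σ = Equiv.swap 0 1 ∨ σ = Equiv.swap 0 2 ∨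
      σ = Equiv.swap 1 2 ∨ σ = Equiv.swap 0 1 * Equiv.swap 1 2 ∨
      σ = Equiv.swap 1 2 * Equiv.swap 0 1 := by decide
  have hval : ∀ σ : Equiv.Perm (Fin 3), permTrace σ (1 : Matrix (Fin m) (Fin m) ℂ) =
      ∑ x : Fin m, ∑ y : Fin m, ∑ z : Fin m, if ∀ s, (![x, y, z] : Fin 3 → Fin m) s =
        ![x, y, z] (σ s) then 1 else 0 := fun σ => by
    rw [permTrace_one, sum_fin_three_arrow]
    simp only [funext_iff, Function.comp_apply]
  have h₁ : (Equiv.swap 0 1 * Equiv.swap 1 2 : Equiv.Perm (Fin 3)) ≠ 1 := by decide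
  have h₂ : (Equiv.swap 1 2 * Equiv.swap 0 1 : Equiv.Perm (Fin 3)) ≠ 1 := by decide
  rcases h σ with rfl | rfl | rfl | rfl | rfl | rfl
  · rw [permTrace_refl]; simp
  all_goals
    rw [hval]
    simp [Fin.forall_fin_succ, Equiv.swap_apply_def, ite_and, h₁, h₂, sq]

theorem isCycleEigenvector_fin_one : IsCycleEigenvector (α := Fin 1) (fun _ => 1) fun m => m := by
  intro m π
  simp [permTrace_fin_one]

theorem isCycleEigenvector_fin_two {f : Equiv.Perm (Fin 2) → ℤ} {a b : ℤ}
    (ha : ∀ π, ∑ σ, f σ * (if σ * π = 1 then 1 else 0) = a * f π⁻¹)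
    (hb : ∀ π, ∑ σ, f σ * (if σ * π ≠ 1 then 1 else 0) = b * f π⁻¹) :
    IsCycleEigenvector (fun σ => (f σ : ℂ)) fun m => a * (m : ℂ) ^ 2 + b * m := by
  intro m π
  simp only [permTrace_fin_two, mul_add, Finset.sum_add_distrib, ← mul_assoc, ← Finset.sum_mul,
    ← Int.cast_mul, ← Int.cast_sum, ha, hb]
  push_cast
  ring

theorem isCycleEigenvector_fin_two_trivial :
    IsCycleEigenvector (α := Fin 2) (fun _ => ((1 : ℤ) : ℂ))
      fun m => (1 : ℤ) * (m : ℂ) ^ 2 + (1 : ℤ) * m :=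
  isCycleEigenvector_fin_two (f := fun _ => 1) (by decide) (by decide)

theorem isCycleEigenvector_fin_two_sign :
    IsCycleEigenvector (α := Fin 2) (fun σ => ((Equiv.Perm.sign σ : ℤ) : ℂ))
      fun m => (1 : ℤ) * (m : ℂ) ^ 2 + (-1 : ℤ) * m :=
  isCycleEigenvector_fin_two (f := fun σ => Equiv.Perm.sign σ) (by decide) (by decide)

theorem isCycleEigenvector_fin_three {f : Equiv.Perm (Fin 3) → ℤ} {a b c : ℤ}
    (ha : ∀ π, ∑ σ, f σ * (if σ * π = 1 then 1 else 0) = a * f π⁻¹)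
    (hb : ∀ π, ∑ σ, f σ * (if Equiv.Perm.sign (σ * π) = -1 then 1 else 0) = b * f π⁻¹)
    (hc : ∀ π, ∑ σ, f σ * (if σ * π ≠ 1 ∧ Equiv.Perm.sign (σ * π) = 1 then 1 else 0) =
      c * f π⁻¹) :
    IsCycleEigenvector (fun σ => (f σ : ℂ)) fun m => a * (m : ℂ) ^ 3 + b * (m : ℂ) ^ 2 + c * m := by
  intro m π
  simp only [permTrace_fin_three, mul_add, Finset.sum_add_distrib, ← mul_assoc, ← Finset.sum_mul,
    ← Int.cast_mul, ← Int.cast_sum, ha, hb, hc]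
  push_cast
  ring

theorem isCycleEigenvector_fin_three_trivial :
    IsCycleEigenvector (α := Fin 3) (fun _ => ((1 : ℤ) : ℂ))
      fun m => (1 : ℤ) * (m : ℂ) ^ 3 + (3 : ℤ) * (m : ℂ) ^ 2 + (2 : ℤ) * m :=
  isCycleEigenvector_fin_three (f := fun _ => 1) (by decide) (by decide) (by decide)

theorem isCycleEigenvector_fin_three_sign :
    IsCycleEigenvector (α := Fin 3) (fun σ => ((Equiv.Perm.sign σ : ℤ) : ℂ))
      fun m => (1 : ℤ) * (m : ℂ) ^ 3 + (-3 : ℤ) * (m : ℂ) ^ 2 + (2 : ℤ) * m :=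
  isCycleEigenvector_fin_three (f := fun σ => Equiv.Perm.sign σ) (by decide) (by decide) (by decide)

/-- The character of the two-dimensional representation; its boxes have contents `0, 1, -1`, giving
`m (m + 1) (m - 1)`. -/
theorem isCycleEigenvector_fin_three_standard :
    IsCycleEigenvector (α := Fin 3)
      (fun σ => ((if σ = 1 then 2 else if Equiv.Perm.sign σ = 1 then -1 else 0 : ℤ) : ℂ))
      fun m => (1 : ℤ) * (m : ℂ) ^ 3 + (0 : ℤ) * (m : ℂ) ^ 2 + (-1 : ℤ) * m :=
  isCycleEigenvector_fin_three
    (f := fun σ => if σ = 1 then 2 else if Equiv.Perm.sign σ = 1 then -1 else 0)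
    (by decide) (by decide) (by decide)

/-! ### Moments of the gain. -/

theorem ofReal_channelGain_pow {Ω : Type*} (K : ℕ → ℕ)
    (H : (i : ℕ) → Ω → Matrix (Fin (K (i + 1))) (Fin (K i)) ℂ) (n k : ℕ) (ω : Ω) :
    ((channelGain K H n ω ^ k : ℝ) : ℂ) =
      permTrace (1 : Equiv.Perm (Fin k)) (channelProd K (fun i => H i ω) n *
        (channelProd K (fun i => H i ω) n).conjTranspose) := by
  rw [permTrace_refl, Complex.ofReal_pow, channelGain, frobeniusSq_eq_trace, Fintype.card_fin]

section

variable {Ω : Type*} [MeasurableSpace Ω] {μ : Measure Ω} [IsProbabilityMeasure μ] {K : ℕ → ℕ}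
  {n : ℕ} {H : (i : ℕ) → Ω → Matrix (Fin (K (i + 1))) (Fin (K i)) ℂ}

theorem integrable_channelGain_pow
    (hlaw : ∀ i < n, ∀ (j : Fin (K (i + 1))) (k : Fin (K i)),
      HasLaw (fun ω => H i ω j k) stdComplexGaussian μ) (k : ℕ) :
    Integrable (fun ω => channelGain K H n ω ^ k) μ := by
  have hP := hasAllMoments_channelProd hlaw le_rfl
  have hB : ∀ i j, HasAllMoments (fun ω => (channelProd K (fun i => H i ω) n *
      (channelProd K (fun i => H i ω) n).conjTranspose) i j) μ := fun i j => by
    simp only [Matrix.mul_apply, Matrix.conjTranspose_apply]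
    exact .sum _ fun l _ => (hP i l).mul (hP j l).conj
  have h := (HasAllMoments.permTrace hB (1 : Equiv.Perm (Fin k))).integrable.re
  simp only [← ofReal_channelGain_pow] at h
  simpa only [RCLike.re_to_complex, Complex.ofReal_re] using h

theorem integral_channelGain_pow_eq_sum
    (hlaw : ∀ i < n, ∀ (j : Fin (K (i + 1))) (k : Fin (K i)),
      HasLaw (fun ω => H i ω j k) stdComplexGaussian μ)
    (hindep : iIndepFun
      (fun (e : Σ i : Fin n, Fin (K ((i : ℕ) + 1)) × Fin (K (i : ℕ))) (ω : Ω) =>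
        H (e.1 : ℕ) ω e.2.1 e.2.2) μ)
    {k : ℕ} {ι : Type*} [Fintype ι] (w : ι → ℂ) {f : ι → Equiv.Perm (Fin k) → ℂ} {c : ι → ℕ → ℂ}
    (hf : ∀ i, IsCycleEigenvector (f i) (c i))
    (hw : ∀ σ, ∑ i, w i * f i σ = if σ = 1 then 1 else 0) :
    ((∫ ω, channelGain K H n ω ^ k ∂μ : ℝ) : ℂ) =
      ∑ i, w i * (f i 1 * ∏ j ∈ Finset.range (n + 1), c i (K j)) := by
  simp_rw [← fun i => integral_sum_mul_permTrace_channelProd hlaw hindep (hf i) le_rfl]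
  simp_rw [Finset.mul_sum]
  rw [Finset.sum_comm]
  simp_rw [← mul_assoc, ← Finset.sum_mul, hw]
  rw [← integral_complex_ofReal]
  simp_rw [ofReal_channelGain_pow]
  simp

end

theorem corollary1 {Ω : Type*} [MeasurableSpace Ω] (μ : Measure Ω) [IsProbabilityMeasure μ]
    (n : ℕ) (K : ℕ → ℕ)
    (H : (i : ℕ) → Ω → Matrix (Fin (K (i + 1))) (Fin (K i)) ℂ)
    (hlaw : ∀ i < n, ∀ (j : Fin (K (i + 1))) (k : Fin (K i)),
      HasLaw (fun ω => H i ω j k) stdComplexGaussian μ)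
    (hindep : iIndepFun
      (fun (e : Σ i : Fin n, Fin (K ((i : ℕ) + 1)) × Fin (K (i : ℕ))) (ω : Ω) =>
        H (e.1 : ℕ) ω e.2.1 e.2.2) μ) :
    (Integrable (fun ω => channelGain K H n ω) μ ∧
      ∫ ω, channelGain K H n ω ∂μ = ∏ i ∈ Finset.range (n + 1), (K i : ℝ)) ∧
    (Integrable (fun ω => channelGain K H n ω ^ 2) μ ∧
      ∫ ω, channelGain K H n ω ^ 2 ∂μ =
        (∏ i ∈ Finset.range (n + 1), (K i : ℝ)) / 2 *
          (∏ i ∈ Finset.range (n + 1), ((K i : ℝ) + 1) +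
            ∏ i ∈ Finset.range (n + 1), ((K i : ℝ) - 1))) ∧
    (Integrable (fun ω => channelGain K H n ω ^ 3) μ ∧
      ∫ ω, channelGain K H n ω ^ 3 ∂μ =
        (∏ i ∈ Finset.range (n + 1), (K i : ℝ)) / 6 *
          ((∏ i ∈ Finset.range (n + 1), ((K i : ℝ) + 2) * ((K i : ℝ) + 1)) +
            4 * (∏ i ∈ Finset.range (n + 1), ((K i : ℝ) + 1) * ((K i : ℝ) - 1)) +
            ∏ i ∈ Finset.range (n + 1), ((K i : ℝ) - 1) * ((K i : ℝ) - 2))) := by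
  refine ⟨⟨by simpa using integrable_channelGain_pow hlaw 1, ?_⟩,
    ⟨integrable_channelGain_pow hlaw 2, ?_⟩, integrable_channelGain_pow hlaw 3, ?_⟩ <;>
    apply Complex.ofReal_injective
  · have h := integral_channelGain_pow_eq_sum hlaw hindep (k := 1) (fun _ : Unit => 1)
      (fun _ => isCycleEigenvector_fin_one) (fun σ => by simp [Subsingleton.elim σ 1])
    simpa using h
  · have h := integral_channelGain_pow_eq_sum hlaw hindep ![1 / 2, 1 / 2]
      (f := ![_, _]) (c := ![_, _])
      (Fin.forall_fin_two.mpr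
        ⟨isCycleEigenvector_fin_two_trivial, isCycleEigenvector_fin_two_sign⟩) (fun σ => by
        have h : (1 : ℤ) + Equiv.Perm.sign σ = if σ = 1 then 2 else 0 := by revert σ; decide
        have h' := congrArg (fun x : ℤ => (x : ℂ)) h
        simp only [Int.cast_add, Int.cast_ite, Int.cast_one, Int.cast_ofNat, Int.cast_zero] at h'
        simp only [Fin.sum_univ_two, Matrix.cons_val_zero, Matrix.cons_val_one]
        split_ifs at h' ⊢ <;> linear_combination (1 / 2) * h')
    rw [h]
    simp only [Fin.sum_univ_two, Matrix.cons_val_zero, Matrix.cons_val_one]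
    push_cast
    simp only [mul_add, div_mul_eq_mul_div, ← Finset.prod_mul_distrib, Equiv.Perm.sign_one,
      Units.val_one, Int.cast_one]
    ring_nf
  -- Weights `dim / 3!` for the trivial, standard and sign characters; the value `2` of the standard
  -- character at the identity turns `1 / 3` into the coefficient `4 / 6`.
  · have h := integral_channelGain_pow_eq_sum hlaw hindep ![1 / 6, 1 / 3, 1 / 6]
      (f := ![_, _, _]) (c := ![_, _, _])
      (by
        intro i
        fin_cases i
        · exact isCycleEigenvector_fin_three_trivial
        · exact isCycleEigenvector_fin_three_standard
        · exact isCycleEigenvector_fin_three_sign) (fun σ => by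
        have h : (1 : ℤ) + 2 * (if σ = 1 then 2 else if Equiv.Perm.sign σ = 1 then -1 else 0) +
          Equiv.Perm.sign σ = if σ = 1 then 6 else 0 := by revert σ; decide
        have h' := congrArg (fun x : ℤ => (x : ℂ)) h
        simp only [Int.cast_add, Int.cast_mul, Int.cast_ite, Int.cast_one, Int.cast_ofNat,
          Int.cast_neg, Int.cast_zero] at h'
        simp only [Fin.sum_univ_three, Matrix.cons_val]
        push_cast
        split_ifs at h' ⊢ <;> linear_combination (1 / 6) * h')
    rw [h]
    have h₁ : (∏ i ∈ Finset.range (n + 1), (K i : ℂ)) *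
        ∏ i ∈ Finset.range (n + 1), ((K i : ℂ) + 2) * ((K i : ℂ) + 1) =
        ∏ i ∈ Finset.range (n + 1), ((1 : ℤ) * (K i : ℂ) ^ 3 + (3 : ℤ) * (K i : ℂ) ^ 2 +
          (2 : ℤ) * K i) := by
      rw [← Finset.prod_mul_distrib]
      exact Finset.prod_congr rfl fun i _ => by push_cast; ring
    have h₂ : (∏ i ∈ Finset.range (n + 1), (K i : ℂ)) *
        ∏ i ∈ Finset.range (n + 1), ((K i : ℂ) + 1) * ((K i : ℂ) - 1) =
        ∏ i ∈ Finset.range (n + 1), ((1 : ℤ) * (K i : ℂ) ^ 3 + (0 : ℤ) * (K i : ℂ) ^ 2 +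
          (-1 : ℤ) * K i) := by
      rw [← Finset.prod_mul_distrib]
      exact Finset.prod_congr rfl fun i _ => by push_cast; ring
    have h₃ : (∏ i ∈ Finset.range (n + 1), (K i : ℂ)) *
        ∏ i ∈ Finset.range (n + 1), ((K i : ℂ) - 1) * ((K i : ℂ) - 2) =
        ∏ i ∈ Finset.range (n + 1), ((1 : ℤ) * (K i : ℂ) ^ 3 + (-3 : ℤ) * (K i : ℂ) ^ 2 +
          (2 : ℤ) * K i) := by
      rw [← Finset.prod_mul_distrib]
      exact Finset.prod_congr rfl fun i _ => by push_cast; ring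
    simp only [Fin.sum_univ_three, Matrix.cons_val]
    rw [← h₁, ← h₂, ← h₃]
    push_cast
    simp only [Equiv.Perm.sign_one, Units.val_one, Int.cast_one]
    ring
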